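/- **Theorem (PAC-learning of $g$ and $G$).** Let $\mathcal X\subset\mathbb R^n$ be compact with differentiable boundary, let $f:\mathbb R^n\to\mathbb R^n$ be Lipschitz with $f(x)\cdot\nu(x)=0$ for all $x\in\partial\mathcal X$, where $\nu$ is the outward unit normal, and let $x(t;x_0)$ be the solution of $\dot x=f(x)$, $x(0)=x_0\in\mathcal X$. Let $h:\mathcal X\to\mathbb R^m$ ($m\le n$) be continuous, $\mathcal Y=h(\mathcal X)$, and $y(t;x_0)=h(x(t;x_0))$. Fix $\Delta>0$, integers $1\le k<K$, put $T=K\Delta$, and $$y_{\mathrm{seq}}(t;x_0)=\bigl(y(t-(k-1)\Delta;x_0),\dots,y(t-\Delta;x_0),y(t;x_0)\bigr).$$ Assume observability in the following sense: there is a continuous map $G:\mathcal Y^k\to\mathcal X$ with $G(y_{\mathrm{seq}}(t;x_0))=x(t;x_0)$ for all $x_0\in\mathcal X$ and all $t=l\Delta$, $k-1\le l\le K$. (Then $g=h\circ S_\Delta\circ G$, with $S_\Delta(x)=x(\Delta;x)$ the time-$\Delta$ flow, is a continuous autoregressive map with $g(y_{\mathrm{seq}}(t;x_0))=y(t+\Delta;x_0)$.)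 Let $\mu$ be a probability measure on $\mathcal X$ with a continuous, strictly positive Lebesgue density on $\mathcal X$. For $\eta_g:(\mathbb R^m)^k\to\mathbb R^m$ and $\eta_G:(\mathbb R^m)^k\to\mathbb R^n$ define the risks $$\mathcal L_{g,T}(\eta_g)=\mathbb E_{x_0\sim\mu}\Bigl[\tfrac1{K-k}\sum_{l=k}^{K-1}\|\eta_g(y_{\mathrm{seq}}(l\Delta;x_0))-y((l+1)\Delta;x_0)\|^2\Bigr],$$ $$\mathcal L_{G,T}(\eta_G)=\mathbb E_{x_0\sim\mu}\Bigl[\tfrac1{K-k+1}\sum_{l=k}^{K}\|\eta_G(y_{\mathrm{seq}}(l\Delta;x_0))-x(l\Delta;x_0)\|^2\Bigr],$$ and let $\hat{\mathcal L}_{g,N,T}$, $\hat{\mathcal L}_{G,N,T}$ be the empirical risks obtained by replacing $\mathbb E_{x_0\sim\mu}$ by the average over $N$ initial states $x_0^{(1)},\dots,x_0^{(N)}$ drawn independently from $\mu$. Let $\sigma:\mathbb R\to\mathbb R$ be any continuous activation function that is not a polynomial. Then for all $\varepsilon,\delta>0$ there are hypothesis spaces $\mathcal H_g$ and $\mathcal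 H_G$, each consisting of all fully connected $\sigma$-networks of some fixed depth and width whose weights and biases are bounded in absolute value by some fixed constant, and an integer $N(\varepsilon,\delta)$, such that for every $N\ge N(\varepsilon,\delta)$ empirical risk minimizers exist for every sample and all choices $$\hat\eta_{g,N,T}\in\operatorname*{argmin}_{\eta\in\mathcal H_g}\hat{\mathcal L}_{g,N,T}(\eta),\qquad \hat\eta_{G,N,T}\in\operatorname*{argmin}_{\eta\in\mathcal H_G}\hat{\mathcal L}_{G,N,T}(\eta)$$ satisfy $$P\bigl(\mathcal L_{g,T}(\hat\eta_{g,N,T})\le\varepsilon\bigr)\ge1-\delta\quad\text{and}\quad P\bigl(\mathcal L_{G,T}(\hat\eta_{G,N,T})\le\varepsilon\bigr)\ge1-\delta .$$ -/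

import Mathlib

open MeasureTheory Set

noncomputable section

namespace WorldModel

/-! ### The dynamical system -/

/-- `ν` is the outward unit normal of `X` at `p`: near `p` the set `X` is the sublevel set
`{ρ ≤ 0}` of a differentiable function `ρ` with nowhere vanishing gradient, and `ν` is the
normalised gradient of `ρ` at `p`. -/
def IsOutwardUnitNormal {n : ℕ} (X : Set (EuclideanSpace ℝ (Fin n)))
    (p ν : EuclideanSpace ℝ (Fin n)) : Prop :=
  ∃ (U : Set (EuclideanSpace ℝ (Fin n))) (ρ : EuclideanSpace ℝ (Fin n) → ℝ),
    IsOpen U ∧ p ∈ U ∧ DifferentiableOn ℝ ρ U ∧ (∀ x ∈ U, gradient ρ x ≠ 0) ∧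
    (∀ x ∈ U, x ∈ X ↔ ρ x ≤ 0) ∧ ν = (‖gradient ρ p‖)⁻¹ • gradient ρ p

/-- The boundary of `X` is differentiable: every boundary point has an outward unit normal. -/
def HasDifferentiableBoundary {n : ℕ} (X : Set (EuclideanSpace ℝ (Fin n))) : Prop :=
  ∀ p ∈ frontier X, ∃ ν, IsOutwardUnitNormal X p ν

/-- `f(p) · ν(p) = 0` at every boundary point `p` of `X`. -/
def IsTangentToBoundary {n : ℕ} (X : Set (EuclideanSpace ℝ (Fin n)))
    (f : EuclideanSpace ℝ (Fin n) → EuclideanSpace ℝ (Fin n)) : Prop :=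
  ∀ p ∈ frontier X, ∀ ν, IsOutwardUnitNormal X p ν → inner ℝ (f p) ν = 0

open scoped Classical in
/-- The state `x(t; x₀)` at time `t` of the solution of `ẋ = f(x)`, `x(0) = x₀`.  (For Lipschitz `f`
the global solution exists and is unique; if there is none, the value is `x₀`.) -/
def trajectory {n : ℕ} (f : EuclideanSpace ℝ (Fin n) → EuclideanSpace ℝ (Fin n)) (t : ℝ)
    (x₀ : EuclideanSpace ℝ (Fin n)) : EuclideanSpace ℝ (Fin n) :=
  if hx : ∃ γ : ℝ → EuclideanSpace ℝ (Fin n), γ 0 = x₀ ∧ IsIntegralCurve γ (fun _ => f)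
  then Classical.choose hx t else x₀

/-- The tokenized dynamics `y(t; x₀) = h(x(t; x₀))`. -/
def token {n m : ℕ} (f : EuclideanSpace ℝ (Fin n) → EuclideanSpace ℝ (Fin n))
    (h : EuclideanSpace ℝ (Fin n) → EuclideanSpace ℝ (Fin m)) (t : ℝ)
    (x₀ : EuclideanSpace ℝ (Fin n)) : EuclideanSpace ℝ (Fin m) :=
  h (trajectory f t x₀)

/-- The measurement sequence `(y(t-(k-1)Δ; x₀), …, y(t-Δ; x₀), y(t; x₀))`. -/
def tokenSeq {n m : ℕ} (f : EuclideanSpace ℝ (Fin n) → EuclideanSpace ℝ (Fin n))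
    (h : EuclideanSpace ℝ (Fin n) → EuclideanSpace ℝ (Fin m)) (Δ : ℝ) (k : ℕ) (t : ℝ)
    (x₀ : EuclideanSpace ℝ (Fin n)) : Fin k → EuclideanSpace ℝ (Fin m) :=
  fun i => token f h (t - ((k : ℝ) - 1 - (i : ℕ)) * Δ) x₀

/-- `G : Y ^ k → X`, with `Y = h(X)`, is a continuous reconstruction map on the time grid
`{0, Δ, …, KΔ}`: `G(y_seq(t; x₀)) = x(t; x₀)` for every initial state `x₀ ∈ X` and all times
`t = lΔ`, `k - 1 ≤ l ≤ K`, at which a full history of length `k` is available. -/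
structure IsReconstructionMap {n m : ℕ} (X : Set (EuclideanSpace ℝ (Fin n)))
    (f : EuclideanSpace ℝ (Fin n) → EuclideanSpace ℝ (Fin n))
    (h : EuclideanSpace ℝ (Fin n) → EuclideanSpace ℝ (Fin m)) (Δ : ℝ) (k K : ℕ)
    (G : (Fin k → EuclideanSpace ℝ (Fin m)) → EuclideanSpace ℝ (Fin n)) : Prop where
  continuousOn : ContinuousOn G (Set.univ.pi fun _ => h '' X)
  mapsTo : MapsTo G (Set.univ.pi fun _ => h '' X) X
  reconstructs : ∀ x₀ ∈ X, ∀ l : ℕ, k ≤ l + 1 → l ≤ K →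
    G (tokenSeq f h Δ k ((l : ℝ) * Δ) x₀) = trajectory f ((l : ℝ) * Δ) x₀

/-- `μ` is a probability measure on `X` with a continuous, strictly positive density on `X`
with respect to Lebesgue measure. -/
def HasPositiveContinuousDensityOn {n : ℕ} (μ : Measure (EuclideanSpace ℝ (Fin n)))
    (X : Set (EuclideanSpace ℝ (Fin n))) : Prop :=
  IsProbabilityMeasure μ ∧ ∃ fμ : EuclideanSpace ℝ (Fin n) → ℝ,
    ContinuousOn fμ X ∧ (∀ x ∈ X, 0 < fμ x) ∧
    μ = (volume.restrict X).withDensity fun x => ENNReal.ofReal (fμ x)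

/-! ### Fully connected neural networks -/

/-- An affine layer: a weight matrix and a bias vector. -/
abbrev Layer (ι κ : Type) : Type := Matrix κ ι ℝ × (κ → ℝ)

/-- The affine map `v ↦ A v + b` of a layer. -/
def Layer.apply {ι κ : Type} [Fintype ι] (A : Layer ι κ) (v : ι → ℝ) : κ → ℝ :=
  A.1.mulVec v + A.2

/-- All weights and biases of the layer are bounded by `M` in absolute value. -/
def Layer.BoundedBy {ι κ : Type} (M : ℝ) (A : Layer ι κ) : Prop :=
  (∀ i j, |A.1 i j| ≤ M) ∧ ∀ i, |A.2 i| ≤ M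

/-- Parameters of a fully connected network with input index set `ι`, `L + 1` hidden layers of
width `W`, and output index set `κ`: input layer, `L` inner layers, (affine) output layer. -/
abbrev NetParams (ι κ : Type) (L W : ℕ) : Type :=
  Layer ι (Fin W) × (Fin L → Layer (Fin W) (Fin W)) × Layer (Fin W) κ

/-- Composition of the inner layers, each followed by the activation `σ` in every coordinate. -/
def innerForward (σ : ℝ → ℝ) {W : ℕ} :
    (L : ℕ) → (Fin L → Layer (Fin W) (Fin W)) → (Fin W → ℝ) → (Fin W → ℝ)
  | 0, _, v => v
  | L + 1, A, v => innerForward σ L (Fin.tail A) fun i => σ ((A 0).apply v i)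

/-- The function realised by a fully connected network with activation function `σ`. -/
def NetParams.eval (σ : ℝ → ℝ) {ι κ : Type} [Fintype ι] {L W : ℕ} (θ : NetParams ι κ L W)
    (v : ι → ℝ) : κ → ℝ :=
  θ.2.2.apply (innerForward σ L θ.2.1 fun i => σ (θ.1.apply v i))

/-- All weights and biases of the network are bounded by `M` in absolute value. -/
def NetParams.BoundedBy {ι κ : Type} {L W : ℕ} (M : ℝ) (θ : NetParams ι κ L W) : Prop :=
  θ.1.BoundedBy M ∧ (∀ l, (θ.2.1 l).BoundedBy M) ∧ θ.2.2.BoundedBy M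

/-- The hypothesis space of all functions `(ℝ^m)^k → ℝ^q` realised by fully connected neural
networks with activation `σ`, `L + 1` hidden layers of width `W`, and weights and biases bounded
by `M`. -/
def netClass (σ : ℝ → ℝ) (k m q L W : ℕ) (M : ℝ) :
    Set ((Fin k → EuclideanSpace ℝ (Fin m)) → EuclideanSpace ℝ (Fin q)) :=
  {η | ∃ θ : NetParams (Fin k × Fin m) (Fin q) L W, θ.BoundedBy M ∧
    ∀ y, η y = WithLp.toLp 2 (θ.eval σ fun p => y p.1 p.2)}

/-! ### Risks and empirical risk minimization -/

/-- Average over `t ∈ {kΔ, (k+1)Δ, …, (K-1)Δ}` of `‖η(y_seq(t; x₀)) - y(t+Δ; x₀)‖²`. -/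
def tokenLoss {n m : ℕ} (f : EuclideanSpace ℝ (Fin n) → EuclideanSpace ℝ (Fin n))
    (h : EuclideanSpace ℝ (Fin n) → EuclideanSpace ℝ (Fin m)) (Δ : ℝ) (k K : ℕ)
    (η : (Fin k → EuclideanSpace ℝ (Fin m)) → EuclideanSpace ℝ (Fin m))
    (x₀ : EuclideanSpace ℝ (Fin n)) : ℝ :=
  (∑ l ∈ Finset.Ico k K, ‖η (tokenSeq f h Δ k ((l : ℝ) * Δ) x₀)
      - token f h ((l : ℝ) * Δ + Δ) x₀‖ ^ 2) / ((Finset.Ico k K).card : ℝ)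

/-- Average over `t ∈ {kΔ, (k+1)Δ, …, KΔ}` of `‖η(y_seq(t; x₀)) - x(t; x₀)‖²`. -/
def stateLoss {n m : ℕ} (f : EuclideanSpace ℝ (Fin n) → EuclideanSpace ℝ (Fin n))
    (h : EuclideanSpace ℝ (Fin n) → EuclideanSpace ℝ (Fin m)) (Δ : ℝ) (k K : ℕ)
    (η : (Fin k → EuclideanSpace ℝ (Fin m)) → EuclideanSpace ℝ (Fin n))
    (x₀ : EuclideanSpace ℝ (Fin n)) : ℝ :=
  (∑ l ∈ Finset.Icc k K, ‖η (tokenSeq f h Δ k ((l : ℝ) * Δ) x₀)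
      - trajectory f ((l : ℝ) * Δ) x₀‖ ^ 2) / ((Finset.Icc k K).card : ℝ)

/-- The risk: the expectation of a nonnegative loss under `x₀ ∼ μ`, as an extended nonnegative
number. -/
def risk {n : ℕ} {F : Type} (μ : Measure (EuclideanSpace ℝ (Fin n)))
    (loss : F → EuclideanSpace ℝ (Fin n) → ℝ) (η : F) : ENNReal :=
  ∫⁻ x₀, ENNReal.ofReal (loss η x₀) ∂μ

/-- The empirical risk over the trajectories started in `x 0, …, x (N-1)`. -/
def empiricalRisk {n N : ℕ} {F : Type} (loss : F → EuclideanSpace ℝ (Fin n) → ℝ)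
    (x : Fin N → EuclideanSpace ℝ (Fin n)) (η : F) : ℝ :=
  (∑ j, loss η (x j)) / (N : ℝ)

/-- `η ∈ argmin` of the empirical risk over the hypothesis space `H`. -/
def IsERM {n N : ℕ} {F : Type} (loss : F → EuclideanSpace ℝ (Fin n) → ℝ) (H : Set F)
    (x : Fin N → EuclideanSpace ℝ (Fin n)) (η : F) : Prop :=
  η ∈ H ∧ ∀ η' ∈ H, empiricalRisk loss x η ≤ empiricalRisk loss x η'

/-- `Q` holds with probability at least `p`.  Stated through a measurable event contained in `Q`,
since `Q` itself need not be measurable. -/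
def HoldsWithProbAtLeast {Ω : Type} [MeasurableSpace Ω] (P : Measure Ω) (p : ℝ)
    (Q : Ω → Prop) : Prop :=
  ∃ A : Set Ω, MeasurableSet A ∧ (∀ ω ∈ A, Q ω) ∧ ENNReal.ofReal p ≤ P A

/-- Learning guarantee for the hypothesis space `H` and `N` initial states drawn independently
from `μ`: empirical risk minimizers over `H` exist for all samples, and every choice
`ηhat` of an empirical risk minimizer has risk at most `ε` with probability at least `1 - δ`. -/
def ERMSucceeds {n : ℕ} {F : Type} (μ : Measure (EuclideanSpace ℝ (Fin n)))
    (loss : F → EuclideanSpace ℝ (Fin n) → ℝ) (H : Set F) (N : ℕ) (ε δ : ℝ) : Prop :=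
  (∀ x : Fin N → EuclideanSpace ℝ (Fin n), ∃ η, IsERM loss H x η) ∧
  ∀ ηhat : (Fin N → EuclideanSpace ℝ (Fin n)) → F,
    (∀ᵐ x ∂Measure.pi (fun _ : Fin N => μ), IsERM loss H x (ηhat x)) →
    HoldsWithProbAtLeast (Measure.pi fun _ : Fin N => μ) (1 - δ)
      fun x => risk μ loss (ηhat x) ≤ ENNReal.ofReal ε

end WorldModel

end

/-! Both risks measure how well a network reproduces a fixed continuous map on the compact set of
observation sequences: `G` itself for states, `h ∘ S_Δ ∘ G` for tokens. The problem is therefore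
realizable up to approximation error, and three facts suffice.

The flow is defined and continuous on `X` and does not leave it. Invariance is a Grönwall estimate
for the squared distance to `X` (`mem_of_isIntegralCurve_of_isTangentToBoundary`), and it permits
truncating `f` outside `X` to obtain global solutions.

One-hidden-layer networks are dense in the continuous functions on a compact set
(`topologicalClosure_span_comp_affineFeature`). Mollifying `σ` and differentiating in the weight
yields all powers of a linear form, hence exponentials, to which Stone–Weierstrass applies.

Bounding the weights makes the parameter space compact, so the losses have a finite uniform net.
Chebyshev's inequality and a union bound over that net make empirical and true risk close
simultaneously, and a minimizer inherits the small loss of the approximating network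
(`exists_forall_ERMSucceeds`). -/

namespace WorldModel

open Filter Topology ProbabilityTheory

/-! ### The flow on the state space -/

/-- A tangential vector field has no component along proximal normals. -/
theorem inner_sub_nonpos_of_isTangentToBoundary {n : ℕ} {X : Set (EuclideanSpace ℝ (Fin n))}
    (hbdry : HasDifferentiableBoundary X)
    {f : EuclideanSpace ℝ (Fin n) → EuclideanSpace ℝ (Fin n)} (hft : IsTangentToBoundary X f)
    {z p : EuclideanSpace ℝ (Fin n)} (hp : p ∈ X) (hz : ∀ q ∈ X, ‖z - p‖ ≤ ‖z - q‖) :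
    inner ℝ (z - p) (f p) ≤ 0 := by
  rcases eq_or_ne z p with rfl | hzp
  · simp
  -- a direction that points into `X` points away from `z`
  have key : ∀ w : EuclideanSpace ℝ (Fin n), (∀ᶠ s in 𝓝[>] (0 : ℝ), p + s • w ∈ X) →
      inner ℝ (z - p) w ≤ 0 := by
    intro w hw
    have h1 : ∀ᶠ s in 𝓝[>] (0 : ℝ), inner ℝ (z - p) w ≤ s * (‖w‖ ^ 2 / 2) := by
      filter_upwards [hw, self_mem_nhdsWithin] with s hs hs0
      have h2 := hz _ hs
      have hs0 : 0 < s := hs0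
      have h3 : ‖z - p‖ ^ 2 ≤ ‖(z - p) - s • w‖ ^ 2 := by
        rw [sub_sub]; gcongr
      rw [norm_sub_sq_real (z - p), inner_smul_right, norm_smul, Real.norm_of_nonneg hs0.le] at h3
      have h4 : s * inner ℝ (z - p) w ≤ s * (s * (‖w‖ ^ 2 / 2)) := by nlinarith
      exact le_of_mul_le_mul_left h4 hs0
    have h5 : Tendsto (fun s : ℝ => s * (‖w‖ ^ 2 / 2)) (𝓝[>] (0 : ℝ)) (𝓝 0) := by
      have : Tendsto (fun s : ℝ => s * (‖w‖ ^ 2 / 2)) (𝓝 (0 : ℝ)) (𝓝 (0 * (‖w‖ ^ 2 / 2))) :=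
        tendsto_id.mul_const _
      rw [zero_mul] at this
      exact this.mono_left nhdsWithin_le_nhds
    exact ge_of_tendsto h5 h1
  have hline : ∀ w : EuclideanSpace ℝ (Fin n),
      Tendsto (fun s : ℝ => p + s • w) (𝓝[>] (0 : ℝ)) (𝓝 p) := by
    intro w
    have : Tendsto (fun s : ℝ => p + s • w) (𝓝 (0 : ℝ)) (𝓝 (p + (0 : ℝ) • w)) :=
      Continuous.tendsto (by fun_prop) _
    rw [zero_smul, add_zero] at this
    exact this.mono_left nhdsWithin_le_nhds
  -- At an interior point the direction `z - p` itself would be admissible in `key`, forcing `z =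
  -- p`.
  have hpf : p ∈ frontier X := by
    refine ⟨subset_closure hp, fun hint => ?_⟩
    have h1 := key (z - p) ((hline (z - p)).eventually (mem_interior_iff_mem_nhds.1 hint))
    rw [real_inner_self_eq_norm_sq] at h1
    have : 0 < ‖z - p‖ := norm_pos_iff.2 (sub_ne_zero.2 hzp)
    nlinarith
  obtain ⟨ν, hν⟩ := hbdry p hpf
  have hfν := hft p hpf ν hν
  obtain ⟨U, ρ, hU, hpU, hρ, hgrad, hXU, rfl⟩ := hν
  have hg : 0 < ‖gradient ρ p‖ := norm_pos_iff.2 (hgrad p hpU)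
  have hfg : inner ℝ (gradient ρ p) (f p) = 0 := by
    rw [inner_smul_right] at hfν
    rw [real_inner_comm]
    exact (mul_eq_zero.1 hfν).resolve_left (inv_ne_zero hg.ne')
  have hdesc : ∀ w : EuclideanSpace ℝ (Fin n), inner ℝ (gradient ρ p) w < 0 →
      inner ℝ (z - p) w ≤ 0 := by
    intro w hw
    refine key w ?_
    have hd : DifferentiableAt ℝ ρ p := (hρ p hpU).differentiableAt (hU.mem_nhds hpU)
    have hd1 : HasDerivAt (fun s : ℝ => ρ (p + s • w)) (inner ℝ (gradient ρ p) w) 0 := by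
      have h1 : HasFDerivAt ρ (InnerProductSpace.toDual ℝ _ (gradient ρ p)) (p + (0 : ℝ) • w) := by
        rw [zero_smul, add_zero]; exact hd.hasGradientAt.hasFDerivAt
      have h2 : HasDerivAt (fun s : ℝ => p + s • w) w 0 := by
        simpa using ((hasDerivAt_id (0 : ℝ)).smul_const w).const_add p
      simpa [Function.comp_def] using h1.comp_hasDerivAt (0 : ℝ) h2
    have hd2 := (hasDerivAt_iff_tendsto_slope.1 hd1).mono_left
      (nhdsWithin_mono (0 : ℝ) (fun s (hs : 0 < s) => hs.ne'))
    filter_upwards [hd2.eventually (gt_mem_nhds hw), self_mem_nhdsWithin,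
      (hline w).eventually (hU.mem_nhds hpU)] with s hs hs0 hsU
    rw [hXU _ hsU]
    have hs0 : 0 < s := hs0
    have hρp : ρ p ≤ 0 := (hXU p hpU).1 hp
    rw [slope_def_field, sub_zero, div_lt_iff₀ hs0] at hs
    simp only [zero_smul, add_zero, zero_mul] at hs
    linarith
  -- `f p` is orthogonal to the gradient, hence only a borderline direction. Tilting it by `-τ ∇ρ`
  -- gives a strict descent direction, and `τ → 0` recovers `f p`.
  have h2 : ∀ᶠ τ in 𝓝[>] (0 : ℝ),
      inner ℝ (z - p) (f p) ≤ τ * inner ℝ (z - p) (gradient ρ p) := by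
    filter_upwards [self_mem_nhdsWithin] with τ hτ
    have hτ : 0 < τ := hτ
    have h3 := hdesc (f p - τ • gradient ρ p) (by
      rw [inner_sub_right, hfg, inner_smul_right, real_inner_self_eq_norm_sq]
      have : 0 < τ * ‖gradient ρ p‖ ^ 2 := by positivity
      linarith)
    rw [inner_sub_right, inner_smul_right] at h3
    linarith
  have h5 : Tendsto (fun s : ℝ => s * inner ℝ (z - p) (gradient ρ p)) (𝓝[>] (0 : ℝ)) (𝓝 0) := by
    have : Tendsto (fun s : ℝ => s * inner ℝ (z - p) (gradient ρ p)) (𝓝 (0 : ℝ))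
      (𝓝 (0 * inner ℝ (z - p) (gradient ρ p))) := tendsto_id.mul_const _
    rw [zero_mul] at this
    exact this.mono_left nhdsWithin_le_nhds
  exact ge_of_tendsto h5 h2

/-- A compact set with differentiable boundary is forward invariant under the flow of a Lipschitz
vector field that is tangent to its boundary. -/
theorem mem_of_isIntegralCurve_of_isTangentToBoundary {n : ℕ} {X : Set (EuclideanSpace ℝ (Fin n))}
    (hX : IsCompact X) (hbdry : HasDifferentiableBoundary X)
    {f : EuclideanSpace ℝ (Fin n) → EuclideanSpace ℝ (Fin n)} {Lf : NNReal}
    (hf : LipschitzWith Lf f) (hft : IsTangentToBoundary X f)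
    {γ : ℝ → EuclideanSpace ℝ (Fin n)} (hγ : IsIntegralCurve γ (fun _ => f)) (h0 : γ 0 ∈ X)
    {t : ℝ} (ht : 0 ≤ t) : γ t ∈ X := by
  have hne : X.Nonempty := ⟨_, h0⟩
  have hcont : Continuous γ := hγ.continuous
  -- The squared distance to `X` need not be differentiable, so Grönwall is used in the form that
  -- only bounds right difference quotients.
  have hle := le_gronwallBound_of_liminf_deriv_right_le (a := 0) (b := t) (δ := 0) (ε := 0)
    (f := fun s => Metric.infDist (γ s) X ^ 2) (K := 2 * Lf)
    (f' := fun s => 2 * Lf * Metric.infDist (γ s) X ^ 2)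
    (by fun_prop) ?_ (by simp [Metric.infDist_zero_of_mem h0]) (fun s _ => by simp)
    t ⟨ht, le_rfl⟩
  · rw [gronwallBound_ε0_δ0] at hle
    have h1 : Metric.infDist (γ t) X = 0 := by
      have := Metric.infDist_nonneg (x := γ t) (s := X)
      nlinarith
    exact (hX.isClosed.mem_iff_infDist_zero hne).2 h1
  · intro s _ r hr
    -- Freeze a nearest point `p`: `‖γ u - p‖ ^ 2` is differentiable, dominates the squared distance
    -- and agrees with it at `u = s`. In its derivative the `f p` part is nonpositive by tangency;
    -- the rest is controlled by the Lipschitz bound.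
    obtain ⟨p, hp, hpd⟩ := hX.exists_infDist_eq_dist hne (γ s)
    rw [hpd] at hr
    have hin := inner_sub_nonpos_of_isTangentToBoundary hbdry hft (z := γ s) hp (fun q hq => by
      rw [← dist_eq_norm, ← dist_eq_norm, ← hpd]
      exact Metric.infDist_le_dist_of_mem hq)
    have hder : HasDerivAt (fun u => ‖γ u - p‖ ^ 2) (2 * inner ℝ (γ s - p) (f (γ s))) s :=
      ((hγ s).sub_const p).norm_sq
    have hbound : 2 * inner ℝ (γ s - p) (f (γ s)) ≤ 2 * Lf * dist (γ s) p ^ 2 := by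
      have h1 : inner ℝ (γ s - p) (f (γ s)) =
          inner ℝ (γ s - p) (f (γ s) - f p) + inner ℝ (γ s - p) (f p) := by
        rw [inner_sub_right]; ring
      have h2 := real_inner_le_norm (γ s - p) (f (γ s) - f p)
      have h3 := hf.dist_le_mul (γ s) p
      rw [dist_eq_norm, dist_eq_norm] at h3
      rw [dist_eq_norm]
      nlinarith [norm_nonneg (γ s - p)]
    have hd2 := (hasDerivAt_iff_tendsto_slope.1 hder).mono_left
      (nhdsWithin_mono s (fun u (hu : s < u) => hu.ne'))
    refine Eventually.frequently ?_
    filter_upwards [hd2.eventually (gt_mem_nhds (hbound.trans_lt hr)), self_mem_nhdsWithin]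
      with u hu hsu
    have hsu : 0 < u - s := sub_pos.2 hsu
    refine lt_of_le_of_lt ?_ hu
    rw [slope_def_field, div_eq_inv_mul, hpd, dist_eq_norm]
    gcongr
    · exact Metric.infDist_nonneg
    rw [← dist_eq_norm]
    exact Metric.infDist_le_dist_of_mem hp

/-- A bounded Lipschitz vector field has global integral curves. -/
theorem exists_isIntegralCurve_of_lipschitzWith_of_bounded {E : Type*} [NormedAddCommGroup E]
    [NormedSpace ℝ E] [CompleteSpace E] {f : E → E} {L C : NNReal} (hf : LipschitzWith L f)
    (hC : ∀ x, ‖f x‖ ≤ C) (x₀ : E) :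
    ∃ γ : ℝ → E, γ 0 = x₀ ∧ IsIntegralCurve γ (fun _ => f) := by
  have hloc : ∀ T : NNReal, ∃ α : ℝ → E, α 0 = x₀ ∧
      ∀ t ∈ Icc (-T : ℝ) T, HasDerivWithinAt α (f (α t)) (Icc (-T : ℝ) T) t := by
    intro T
    -- The global bound on `f` allows a ball of radius `C * T`, so the time interval can have any
    -- length.
    have hpl : IsPicardLindelof (fun _ => f) (tmin := -T) (tmax := T) ⟨0, by simp⟩ x₀ (C * T) 0 C L :=
      IsPicardLindelof.of_time_independent (fun x _ => hC x) hf.lipschitzOnWith (by simp)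
    exact hpl.exists_eq_forall_mem_Icc_hasDerivWithinAt₀
  choose α hα0 hα using hloc
  have hα' : ∀ (T : NNReal), ∀ t ∈ Ioo (-T : ℝ) T, HasDerivAt (α T) (f (α T t)) t := fun T t ht =>
    (hα T t (Ioo_subset_Icc_self ht)).hasDerivAt (Icc_mem_nhds ht.1 ht.2)
  have huniq : ∀ S T : NNReal, 0 < S → S ≤ T → EqOn (α S) (α T) (Ioo (-S : ℝ) S) := by
    intro S T hS hST
    have hS' : (0 : ℝ) < S := hS
    have hST' : (S : ℝ) ≤ T := hST
    refine ODE_solution_unique_of_mem_Ioo (v := fun _ => f) (s := fun _ => univ) (K := L) (t₀ := 0)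
      (fun t _ => hf.lipschitzOnWith) ⟨by linarith, hS'⟩ (fun t ht => ⟨hα' S t ht, trivial⟩)
      (fun t ht => ⟨hα' T t ⟨by linarith [ht.1], by linarith [ht.2]⟩, trivial⟩)
      (by rw [hα0, hα0])
  -- Glue the local solutions: the margin `1` keeps `t` interior, and uniqueness makes the choices
  -- agree nearby.
  refine ⟨fun t => α (‖t‖₊ + 1) t, by simp [hα0], fun t => ?_⟩
  have hmem : t ∈ Ioo (-((‖t‖₊ + 1 : NNReal) : ℝ)) ((‖t‖₊ + 1 : NNReal) : ℝ) := by
    simp only [NNReal.coe_add, coe_nnnorm, Real.norm_eq_abs, NNReal.coe_one]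
    exact ⟨by linarith [neg_abs_le t], by linarith [le_abs_self t]⟩
  refine (hα' (‖t‖₊ + 1) t hmem).congr_of_eventuallyEq ?_
  filter_upwards [Ioo_mem_nhds hmem.1 hmem.2] with s hs
  have hmem' : s ∈ Ioo (-((‖s‖₊ + 1 : NNReal) : ℝ)) ((‖s‖₊ + 1 : NNReal) : ℝ) := by
    simp only [NNReal.coe_add, coe_nnnorm, Real.norm_eq_abs, NNReal.coe_one]
    exact ⟨by linarith [neg_abs_le s], by linarith [le_abs_self s]⟩
  rcases le_total (‖s‖₊ + 1) (‖t‖₊ + 1) with h | h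
  · exact huniq _ _ (by positivity) h hmem'
  · exact (huniq _ _ (by positivity) h hs).symm

/-- A Lipschitz vector field tangent to the boundary of the compact set `X` has global integral
curves through the points of `X`. -/
theorem exists_isIntegralCurve_of_mem {n : ℕ} {X : Set (EuclideanSpace ℝ (Fin n))}
    (hX : IsCompact X) (hbdry : HasDifferentiableBoundary X)
    {f : EuclideanSpace ℝ (Fin n) → EuclideanSpace ℝ (Fin n)} {Lf : NNReal}
    (hf : LipschitzWith Lf f) (hft : IsTangentToBoundary X f)
    {x₀ : EuclideanSpace ℝ (Fin n)} (hx₀ : x₀ ∈ X) :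
    ∃ γ : ℝ → EuclideanSpace ℝ (Fin n), γ 0 = x₀ ∧ IsIntegralCurve γ (fun _ => f) := by
  obtain ⟨R, hR0, hR⟩ := hX.isBounded.exists_pos_norm_le
  -- truncate the vector field by clamping the coordinates to `[-R, R]`
  let c : EuclideanSpace ℝ (Fin n) → EuclideanSpace ℝ (Fin n) :=
    fun x => WithLp.toLp 2 fun i => max (-R) (min R (x i))
  have hc : LipschitzWith 1 c := by
    refine LipschitzWith.of_dist_le_mul fun x y => ?_
    rw [NNReal.coe_one, one_mul, EuclideanSpace.dist_eq, EuclideanSpace.dist_eq]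
    refine Real.sqrt_le_sqrt (Finset.sum_le_sum fun i _ => ?_)
    gcongr
    have h1 : LipschitzWith 1 fun s : ℝ => max (-R) (min R s) :=
      (LipschitzWith.id.const_min R).const_max (-R)
    simpa [c] using h1.dist_le_mul (x i) (y i)
  have hcX : ∀ x ∈ X, c x = x := by
    intro x hx
    ext i
    have h1 := (PiLp.norm_apply_le x i).trans (hR x hx)
    rw [Real.norm_eq_abs, abs_le] at h1
    simp [c, h1.1, h1.2]
  have hfc : LipschitzWith Lf (f ∘ c) := by simpa using hf.comp hc
  have hbdd : ∃ C : NNReal, ∀ x, ‖(f ∘ c) x‖ ≤ C := by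
    have hK : IsCompact (WithLp.toLp 2 '' (Icc (fun _ => -R) fun _ => R : Set (Fin n → ℝ))) :=
      isCompact_Icc.image (PiLp.continuous_toLp 2 _)
    obtain ⟨C, hC⟩ := hK.exists_bound_of_continuousOn hf.continuous.continuousOn
    refine ⟨C.toNNReal, fun x => (hC _ ⟨_, ⟨fun i => ?_, fun i => ?_⟩, rfl⟩).trans
      (Real.le_coe_toNNReal C)⟩
    · exact le_max_left _ _
    · exact max_le (by linarith) (min_le_left _ _)
  obtain ⟨C, hC⟩ := hbdd
  obtain ⟨γ, hγ0, hγ⟩ := exists_isIntegralCurve_of_lipschitzWith_of_bounded hfc hC x₀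
  have hXcl := hX.isClosed.frontier_subset
  have hft' : IsTangentToBoundary X (f ∘ c) := fun p hp ν hν => by
    rw [Function.comp_apply, hcX p (hXcl hp)]; exact hft p hp ν hν
  have hft'' : IsTangentToBoundary X fun x => -(f ∘ c) x := fun p hp ν hν => by
    rw [inner_neg_left, hft' p hp ν hν, neg_zero]
  -- A curve of the truncated field stays in `X`, where truncation changes nothing. Negative times
  -- follow by applying invariance to the reversed curve and the field `-(f ∘ c)`.
  have hmem : ∀ t, γ t ∈ X := by
    intro t
    rcases le_total 0 t with ht | ht
    · exact mem_of_isIntegralCurve_of_isTangentToBoundary hX hbdry hfc hft' hγ (hγ0 ▸ hx₀) ht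
    · have hrev : IsIntegralCurve (fun s => γ (-s)) fun _ x => -(f ∘ c) x := fun s => by
        simpa [Function.comp_def] using (hγ (-s)).scomp s (hasDerivAt_neg s)
      simpa using mem_of_isIntegralCurve_of_isTangentToBoundary hX hbdry hfc.neg hft'' hrev
        (by simpa [hγ0] using hx₀) (neg_nonneg.2 ht)
  refine ⟨γ, hγ0, fun t => ?_⟩
  have := hγ t
  simp only [Function.comp_apply] at this
  rwa [hcX _ (hmem t)] at this

section Trajectory

variable {n : ℕ} {X : Set (EuclideanSpace ℝ (Fin n))}
  {f : EuclideanSpace ℝ (Fin n) → EuclideanSpace ℝ (Fin n)} {Lf : NNReal}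

theorem trajectory_spec (hX : IsCompact X) (hbdry : HasDifferentiableBoundary X)
    (hf : LipschitzWith Lf f) (hft : IsTangentToBoundary X f)
    {x₀ : EuclideanSpace ℝ (Fin n)} (hx₀ : x₀ ∈ X) :
    trajectory f 0 x₀ = x₀ ∧ IsIntegralCurve (fun t => trajectory f t x₀) (fun _ => f) := by
  have hx := exists_isIntegralCurve_of_mem hX hbdry hf hft hx₀
  have : (fun t => trajectory f t x₀) = Classical.choose hx := by
    funext t; rw [trajectory, dif_pos hx]
  refine ⟨(congrFun this 0).trans (Classical.choose_spec hx).1, ?_⟩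
  rw [this]
  exact (Classical.choose_spec hx).2

theorem trajectory_mem (hX : IsCompact X) (hbdry : HasDifferentiableBoundary X)
    (hf : LipschitzWith Lf f) (hft : IsTangentToBoundary X f)
    {x₀ : EuclideanSpace ℝ (Fin n)} (hx₀ : x₀ ∈ X) {t : ℝ} (ht : 0 ≤ t) :
    trajectory f t x₀ ∈ X := by
  obtain ⟨h0, hγ⟩ := trajectory_spec hX hbdry hf hft hx₀
  exact mem_of_isIntegralCurve_of_isTangentToBoundary hX hbdry hf hft hγ
    (by simpa only [h0] using hx₀) ht

/-- Both sides solve the same autonomous equation in `t` with equal value at `t = 0`, so ODE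
uniqueness applies. -/
theorem trajectory_add (hX : IsCompact X) (hbdry : HasDifferentiableBoundary X)
    (hf : LipschitzWith Lf f) (hft : IsTangentToBoundary X f)
    {x₀ : EuclideanSpace ℝ (Fin n)} (hx₀ : x₀ ∈ X) {s : ℝ} (hs : 0 ≤ s) (t : ℝ) :
    trajectory f (s + t) x₀ = trajectory f t (trajectory f s x₀) := by
  obtain ⟨-, hγ⟩ := trajectory_spec hX hbdry hf hft hx₀
  obtain ⟨h0, hγ'⟩ := trajectory_spec hX hbdry hf hft (trajectory_mem hX hbdry hf hft hx₀ hs)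
  have h1 : (fun t => trajectory f (s + t) x₀) = fun t => trajectory f t (trajectory f s x₀) := by
    refine ODE_solution_unique_univ (v := fun _ => f) (s := fun _ => univ) (K := Lf) (t₀ := 0)
      (fun _ => hf.lipschitzOnWith) (fun t => ⟨?_, trivial⟩) (fun t => ⟨hγ' t, trivial⟩) ?_
    · exact (hγ (s + t)).comp_const_add s t
    · simp [h0]
  exact congrFun h1 t

/-- Grönwall bounds the divergence of two solutions by the factor `exp (Lf * t)`. -/
theorem continuousOn_trajectory (hX : IsCompact X) (hbdry : HasDifferentiableBoundary X)
    (hf : LipschitzWith Lf f) (hft : IsTangentToBoundary X f) {t : ℝ} (ht : 0 ≤ t) :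
    ContinuousOn (trajectory f t) X := by
  refine LipschitzOnWith.continuousOn (K := (Real.exp (Lf * t)).toNNReal)
    (LipschitzOnWith.of_dist_le_mul fun x hx y hy => ?_)
  obtain ⟨hx0, hγx⟩ := trajectory_spec hX hbdry hf hft hx
  obtain ⟨hy0, hγy⟩ := trajectory_spec hX hbdry hf hft hy
  have := dist_le_of_trajectories_ODE (v := fun _ => f) (K := Lf) (a := 0) (b := t)
    (δ := dist x y) (fun _ => hf)
    hγx.continuous.continuousOn (fun s _ => (hγx s).hasDerivWithinAt)
    hγy.continuous.continuousOn (fun s _ => (hγy s).hasDerivWithinAt)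
    (by rw [hx0, hy0]) t ⟨ht, le_rfl⟩
  rwa [sub_zero, mul_comm, ← Real.coe_toNNReal _ (Real.exp_pos _).le] at this

end Trajectory

/-! ### Universal approximation -/

/-- A smooth function whose derivative of order `n + 1` vanishes is a polynomial of degree at
most `n`. -/
theorem exists_polynomial_of_iteratedDeriv_succ_eq_zero {ψ : ℝ → ℝ} (n : ℕ)
    (hψ : ContDiff ℝ (n + 1) ψ) (h0 : ∀ x, iteratedDeriv (n + 1) ψ x = 0) :
    ∃ p : Polynomial ℝ, p.degree < (n + 1 : ℕ) ∧ ∀ x, ψ x = p.eval x := by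
  refine ⟨∑ j ∈ Finset.range (n + 1),
    Polynomial.C ((j.factorial : ℝ)⁻¹ * iteratedDeriv j ψ 0) * Polynomial.X ^ j, ?_, fun x => ?_⟩
  · refine lt_of_le_of_lt (Polynomial.degree_sum_le _ _) ?_
    rw [Finset.sup_lt_iff (WithBot.bot_lt_coe _)]
    intro j hj
    exact lt_of_le_of_lt (Polynomial.degree_C_mul_X_pow_le _ _)
      (by exact_mod_cast Finset.mem_range.1 hj)
  rw [Polynomial.eval_finsetSum]
  rcases eq_or_ne 0 x with rfl | hx
  · rw [Finset.sum_eq_single 0] <;> simp +contextual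
  obtain ⟨y, -, hy⟩ := taylor_mean_remainder_lagrange_iteratedDeriv (n := n) hx hψ.contDiffOn
  rw [h0, zero_mul, zero_div, sub_eq_zero, taylor_within_apply] at hy
  rw [hy]
  refine Finset.sum_congr rfl fun j hj => ?_
  rw [iteratedDerivWithin_eq_iteratedDeriv (uniqueDiffOn_uIcc hx)
    (hψ.of_le (by exact_mod_cast (Finset.mem_range.1 hj).le)).contDiffAt left_mem_uIcc]
  simp
  ring

/-- A pointwise limit of polynomials of bounded degree is a polynomial. -/
theorem exists_polynomial_of_tendsto {ι : Type*} {l : Filter ι} [l.NeBot] (n : ℕ)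
    {p : ι → Polynomial ℝ} (hp : ∀ i, (p i).degree < n) {g : ℝ → ℝ}
    (hg : ∀ x, Tendsto (fun i => (p i).eval x) l (𝓝 (g x))) :
    ∃ q : Polynomial ℝ, ∀ x, g x = q.eval x := by
  have hinj : Set.InjOn (fun j : ℕ => (j : ℝ)) (Finset.range n) := Nat.cast_injective.injOn
  refine ⟨Lagrange.interpolate (Finset.range n) (fun j : ℕ => (j : ℝ)) fun j => g j, fun x => ?_⟩
  refine tendsto_nhds_unique (hg x) ?_
  -- A polynomial of degree below `n` depends linearly on its values at the `n` nodes, so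
  -- convergence at the nodes determines the limit everywhere.
  have h1 : ∀ i, (p i).eval x = ∑ j ∈ Finset.range n, (p i).eval (j : ℝ) *
      (Lagrange.basis (Finset.range n) (fun j : ℕ => (j : ℝ)) j).eval x := fun i => by
    conv_lhs => rw [Lagrange.eq_interpolate hinj (f := p i) (by simpa using hp i)]
    simp [Lagrange.interpolate_apply, Polynomial.eval_finsetSum]
  simp only [h1, Lagrange.interpolate_apply, Polynomial.eval_finsetSum, Polynomial.eval_mul,
    Polynomial.eval_C]
  exact tendsto_finsetSum _ fun j _ => (hg j).mul_const _

/-- For every order, some mollification of a continuous non-polynomial function has a derivative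
of that order that does not vanish identically. -/
theorem exists_contDiffBump_iteratedDeriv_ne_zero {σ : ℝ → ℝ} (hσ : Continuous σ)
    (hσp : ¬ ∃ p : Polynomial ℝ, ∀ t, σ t = p.eval t) (k : ℕ) :
    ∃ φ : ContDiffBump (0 : ℝ), ∃ b : ℝ,
      iteratedDeriv k (convolution (φ.normed volume) σ (ContinuousLinearMap.lsmul ℝ ℝ) volume) b
        ≠ 0 := by
  by_contra! hcon
  -- Otherwise every mollification is a polynomial of degree at most `k`. This bound is uniform as
  -- the bumps shrink, so the limit `σ` would be a polynomial.
  let φ : ℕ → ContDiffBump (0 : ℝ) := fun i =>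
    ⟨1 / (i + 1 : ℝ) / 2, 1 / (i + 1 : ℝ), by positivity, half_lt_self (by positivity)⟩
  have hφ : Tendsto (fun i => (φ i).rOut) atTop (𝓝 0) := tendsto_one_div_add_atTop_nhds_zero_nat
  have hpoly : ∀ i, ∃ p : Polynomial ℝ, p.degree < (k + 1 : ℕ) ∧ ∀ x,
      convolution ((φ i).normed volume) σ (ContinuousLinearMap.lsmul ℝ ℝ) volume x = p.eval x := by
    intro i
    refine exists_polynomial_of_iteratedDeriv_succ_eq_zero k ?_ fun x => ?_
    · exact_mod_cast (φ i).hasCompactSupport_normed.contDiff_convolution_left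
        (n := (k + 1 : ℕ)) _ (φ i).contDiff_normed hσ.locallyIntegrable
    · rw [iteratedDeriv_succ]
      have : iteratedDeriv k (convolution ((φ i).normed volume) σ
          (ContinuousLinearMap.lsmul ℝ ℝ) volume) = fun _ => 0 := funext fun y => hcon (φ i) y
      rw [this, deriv_const]
  choose p hpdeg hp using hpoly
  refine hσp (exists_polynomial_of_tendsto (l := atTop) (k + 1) hpdeg fun x => ?_)
  simp only [← hp]
  exact ContDiffBump.convolution_tendsto_right_of_continuous hφ hσ x

section Closed

variable {Z : Type*} [TopologicalSpace Z] [CompactSpace Z]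

/-- A closed subspace is complete, so the integral can be formed inside it, and the inclusion
commutes with integration. -/
theorem integral_mem_of_isClosed {α E : Type*} [TopologicalSpace α] [MeasurableSpace α]
    [OpensMeasurableSpace α] {μ : Measure α} [IsFiniteMeasureOnCompacts μ]
    [NormedAddCommGroup E] [NormedSpace ℝ E] [CompleteSpace E] [SecondCountableTopology α]
    {S : Submodule ℝ E} (hS : IsClosed (S : Set E)) {F : α → E} (hF : Continuous F)
    (hFc : HasCompactSupport F) (hFS : ∀ s, F s ∈ S) : ∫ s, F s ∂μ ∈ S := by
  have : CompleteSpace S := hS.completeSpace_coe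
  let F' : α → S := fun s => ⟨F s, hFS s⟩
  have hF' : Continuous F' := hF.subtype_mk _
  have hF'c : HasCompactSupport F' := by
    refine hFc.mono' fun s hs => subset_tsupport _ ?_
    intro h
    exact hs (Subtype.ext h)
  have := S.subtypeL.integral_comp_comm (hF'.integrable_of_hasCompactSupport hF'c (μ := μ))
  simp only [Submodule.subtypeL_apply] at this
  change ∫ s, (F' s : E) ∂μ ∈ S
  rw [this]
  exact Subtype.property _

/-- A closed subspace that contains `σ (w u + b)` contains the same functions for the
mollifications of `σ`. -/
theorem convolution_comp_mem {S : Submodule ℝ C(Z, ℝ)} (hS : IsClosed (S : Set C(Z, ℝ)))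
    (σ : C(ℝ, ℝ)) (v : C(Z, ℝ)) (hv : ∀ s : ℝ, σ.comp (v - .const Z s) ∈ S)
    {φ : ℝ → ℝ} (hφ : Continuous φ) (hφc : HasCompactSupport φ) (ψ : C(ℝ, ℝ))
    (hψ : ∀ x, ψ x = ∫ s, φ s * σ (x - s)) : ψ.comp v ∈ S := by
  -- The mollified function is a Bochner integral of functions in `S`, taken in `C(Z, ℝ)` rather
  -- than pointwise.
  let F : ℝ → C(Z, ℝ) := fun s => φ s • σ.comp (v - .const Z s)
  have hF : Continuous F := by
    refine hφ.smul ((ContinuousMap.continuous_postcomp σ).comp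
      (continuous_const.sub ?_))
    exact ContinuousMap.continuous_const'
  have hFc : HasCompactSupport F := hφc.smul_right
  have h1 : ψ.comp v = ∫ s, F s := by
    ext z
    rw [ContinuousMap.integral_apply (hF.integrable_of_hasCompactSupport hFc)]
    simp [F, hψ]
  rw [h1]
  exact integral_mem_of_isClosed hS hF hFc fun s => S.smul_mem _ (hv s)

/-- Differentiating `w ↦ v ψ(w u + b)` does not lead out of a closed subspace. -/
theorem mul_deriv_comp_mem {S : Submodule ℝ C(Z, ℝ)} (hS : IsClosed (S : Set C(Z, ℝ)))
    (u v c : C(Z, ℝ)) (ψ ψ' : C(ℝ, ℝ)) (hψ : ∀ x, HasDerivAt ψ (ψ' x) x)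
    (h : ∀ w : ℝ, v * ψ.comp (w • u + c) ∈ S) (w : ℝ) :
    v * u * ψ'.comp (w • u + c) ∈ S := by
  let H : ℝ → C(Z, ℝ) := fun w => v * u * ψ'.comp (w • u + c)
  have hH : Continuous H := by
    refine continuous_const.mul ((ContinuousMap.continuous_postcomp ψ').comp ?_)
    exact (continuous_id.smul continuous_const).add continuous_const
  -- The difference quotients must converge in sup norm. Writing the family as the integral of the
  -- continuous `C(Z, ℝ)`-valued map `H` provides this by the fundamental theorem of calculus.
  have hint : (fun w : ℝ => v * ψ.comp (w • u + c)) =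
      fun w => v * ψ.comp ((0 : ℝ) • u + c) + ∫ s in (0 : ℝ)..w, H s := by
    funext w
    ext z
    have hd : ∀ s : ℝ, HasDerivAt (fun s : ℝ => v z * ψ (s * u z + c z)) (H s z) s := by
      intro s
      have h1 : HasDerivAt (fun s : ℝ => s * u z + c z) (u z) s := by
        simpa using ((hasDerivAt_id s).mul_const (u z)).add_const (c z)
      have h2 := ((hψ (s * u z + c z)).comp s h1).const_mul (v z)
      convert! h2 using 1
      simp [H]
      ring
    have hHz : Continuous fun s => H s z := (continuous_eval_const z).comp hH
    have h3 := intervalIntegral.integral_eq_sub_of_hasDerivAt (fun s _ => hd s)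
      (hHz.intervalIntegrable 0 w)
    have h4 := (ContinuousMap.evalCLM ℝ z).intervalIntegral_comp_comm
      (hH.intervalIntegrable (μ := volume) 0 w)
    simp only [ContinuousMap.evalCLM_apply] at h4
    simp only [ContinuousMap.mul_apply, ContinuousMap.comp_apply, ContinuousMap.add_apply,
      ContinuousMap.smul_apply, smul_eq_mul]
    rw [← h4, h3]
    ring
  have hder : HasDerivAt (fun w : ℝ => v * ψ.comp (w • u + c)) (H w) w := by
    rw [hint]
    exact (hH.integral_hasStrictDerivAt 0 w).hasDerivAt.const_add _
  rw [hasDerivAt_iff_tendsto_slope] at hder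
  exact hS.mem_of_tendsto hder (Eventually.of_forall fun s =>
    S.smul_mem _ (S.sub_mem (h s) (h w)))

/-- A closed subspace that contains all `σ (w u + b)`, for a continuous non-polynomial `σ`,
contains all powers of `u`. -/
theorem pow_mem_of_comp_mem {S : Submodule ℝ C(Z, ℝ)} (hS : IsClosed (S : Set C(Z, ℝ)))
    (σ : C(ℝ, ℝ)) (hσp : ¬ ∃ p : Polynomial ℝ, ∀ t, σ t = p.eval t) (u : C(Z, ℝ))
    (h : ∀ w b : ℝ, σ.comp (w • u + .const Z b) ∈ S) (k : ℕ) : u ^ k ∈ S := by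
  obtain ⟨φ, b, hb⟩ := exists_contDiffBump_iteratedDeriv_ne_zero σ.continuous hσp k
  set ψ : ℝ → ℝ := convolution (φ.normed volume) σ (ContinuousLinearMap.lsmul ℝ ℝ) volume with hψ
  have hsmooth : ∀ j : ℕ, ContDiff ℝ j ψ := fun j => by
    exact_mod_cast φ.hasCompactSupport_normed.contDiff_convolution_left
      (n := (j : ℕ)) _ φ.contDiff_normed σ.continuous.locallyIntegrable
  have hcont : ∀ j, Continuous (iteratedDeriv j ψ) := fun j =>
    (hsmooth j).continuous_iteratedDeriv j le_rfl
  have hderiv : ∀ j x, HasDerivAt (iteratedDeriv j ψ) (iteratedDeriv (j + 1) ψ x) x := by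
    intro j x
    rw [iteratedDeriv_succ]
    exact ((hsmooth (j + 1)).differentiable_iteratedDeriv j
      (by exact_mod_cast Nat.lt_succ_self j) x).hasDerivAt
  -- Each derivative in `w` produces a factor `u` and raises the order on `ψ`. At `w = 0` only `u ^
  -- k` times the nonzero constant `iteratedDeriv k ψ b` remains.
  have hmem : ∀ j : ℕ, ∀ w : ℝ,
      u ^ j * (⟨_, hcont j⟩ : C(ℝ, ℝ)).comp (w • u + .const Z b) ∈ S := by
    intro j
    induction j with
    | zero =>
      intro w
      rw [pow_zero, one_mul]
      refine convolution_comp_mem hS σ _ (fun s => ?_) (φ := φ.normed volume)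
        (φ.contDiff_normed (n := 0)).continuous φ.hasCompactSupport_normed _ fun x => ?_
      · convert h w (b - s) using 2
        ext z
        simp [add_sub_assoc]
      · simp [hψ, convolution_lsmul]
    | succ j ih =>
      intro w
      rw [pow_succ]
      exact mul_deriv_comp_mem hS u (u ^ j) (.const Z b) ⟨_, hcont j⟩ ⟨_, hcont (j + 1)⟩
        (hderiv j) ih w
  have h1 := S.smul_mem (iteratedDeriv k ψ b)⁻¹ (hmem k 0)
  convert h1 using 1
  ext z
  simp
  field_simp

/-- The exponential series converges in the Banach algebra `C(Z, ℝ)`, with partial sums in `S`. -/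
theorem exp_comp_mem_of_pow_mem {S : Submodule ℝ C(Z, ℝ)} (hS : IsClosed (S : Set C(Z, ℝ)))
    (u : C(Z, ℝ)) (h : ∀ k : ℕ, u ^ k ∈ S) :
    (⟨Real.exp, Real.continuous_exp⟩ : C(ℝ, ℝ)).comp u ∈ S := by
  have h1 : (⟨Real.exp, Real.continuous_exp⟩ : C(ℝ, ℝ)).comp u = NormedSpace.exp u := by
    ext z
    have := NormedSpace.map_exp (ContinuousMap.evalAlgHom ℝ ℝ z)
      (continuous_eval_const z) u
    rw [← Real.exp_eq_exp_ℝ] at this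
    exact this.symm
  rw [h1]
  have h2 := NormedSpace.exp_series_hasSum_exp' (𝕂 := ℝ) u
  exact hS.mem_of_tendsto h2 (Eventually.of_forall fun s => S.sum_mem fun k _ =>
    S.smul_mem _ (h k))

/-- The affine function `z ↦ a ⬝ e(z) + b` of the features `e`. -/
def affineFeature {ι : Type*} [Fintype ι] (e : C(Z, ι → ℝ)) (a : ι → ℝ) (b : ℝ) : C(Z, ℝ) :=
  ⟨fun z => a ⬝ᵥ e z + b, by fun_prop⟩

/-- **Universal approximation**: for continuous non-polynomial `σ` the functions `σ (a ⬝ x + b)`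
span a dense subspace. -/
theorem topologicalClosure_span_comp_affineFeature {ι : Type*} [Fintype ι] (σ : C(ℝ, ℝ))
    (hσp : ¬ ∃ p : Polynomial ℝ, ∀ t, σ t = p.eval t) (e : C(Z, ι → ℝ))
    (he : Function.Injective e) :
    (Submodule.span ℝ (range fun q : (ι → ℝ) × ℝ =>
      σ.comp (affineFeature e q.1 q.2))).topologicalClosure = ⊤ := by
  classical
  set S := (Submodule.span ℝ (range fun q : (ι → ℝ) × ℝ =>
      σ.comp (affineFeature e q.1 q.2))).topologicalClosure with hSdef
  have hS : IsClosed (S : Set C(Z, ℝ)) := Submodule.isClosed_topologicalClosure _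
  let E : (ι → ℝ) → C(Z, ℝ) := fun a =>
    (⟨Real.exp, Real.continuous_exp⟩ : C(ℝ, ℝ)).comp (affineFeature e a 0)
  have hexp : ∀ a, E a ∈ S := fun a => by
    refine exp_comp_mem_of_pow_mem hS _ (pow_mem_of_comp_mem hS σ hσp _ fun w b => ?_)
    refine Submodule.le_topologicalClosure _ (Submodule.subset_span ⟨(w • a, b), ?_⟩)
    ext z
    simp [affineFeature]
  -- Exponentials of linear forms are closed under products, so their span is already an algebra and
  -- Stone–Weierstrass applies to it.
  let M : Submonoid C(Z, ℝ) :=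
    { carrier := range E
      one_mem' := ⟨0, by ext z; simp [E, affineFeature]⟩
      mul_mem' := by
        rintro _ _ ⟨a, rfl⟩ ⟨b, rfl⟩
        exact ⟨a + b, by ext z; simp [E, affineFeature, add_dotProduct, Real.exp_add]⟩ }
  have hadj : Subalgebra.toSubmodule (Algebra.adjoin ℝ (range E)) = Submodule.span ℝ (range E) :=
    Algebra.adjoin_eq_span_of_subset ℝ fun x hx =>
      Submodule.subset_span ((Submonoid.closure_le (S := M)).2 subset_rfl hx)
  have hsep : (Algebra.adjoin ℝ (range E)).SeparatesPoints := by
    intro x y hxy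
    obtain ⟨i, hi⟩ := Function.ne_iff.1 (he.ne hxy)
    refine ⟨_, ⟨E (Pi.single i 1), Algebra.subset_adjoin ⟨_, rfl⟩, rfl⟩, ?_⟩
    simpa [E, affineFeature] using hi
  have htop := ContinuousMap.subalgebra_topologicalClosure_eq_top_of_separatesPoints _ hsep
  refine top_le_iff.1 fun g _ => ?_
  have hg : g ∈ (Algebra.adjoin ℝ (range E)).topologicalClosure := by rw [htop]; trivial
  have hle : ((Algebra.adjoin ℝ (range E) : Subalgebra ℝ C(Z, ℝ)) : Set C(Z, ℝ)) ⊆ S := by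
    intro x hx
    have : x ∈ Submodule.span ℝ (range E) := hadj ▸ hx
    exact (Submodule.span_le.2 (by rintro _ ⟨a, rfl⟩; exact hexp a)) this
  exact closure_minimal hle hS hg

end Closed

/-! ### Shallow networks -/

section Networks

variable {ι κ : Type}

theorem NetParams.eval_zero [Fintype ι] (σ : ℝ → ℝ) {W : ℕ} (θ : NetParams ι κ 0 W) (v : ι → ℝ) :
    θ.eval σ v = θ.2.2.1.mulVec (fun i => σ ((θ.1.1.mulVec v + θ.1.2) i)) + θ.2.2.2 :=
  rfl

theorem NetParams.continuous_eval_zero [Fintype ι] {σ : ℝ → ℝ} (hσ : Continuous σ) {W : ℕ} :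
    Continuous fun p : NetParams ι κ 0 W × (ι → ℝ) => p.1.eval σ p.2 := by
  simp only [NetParams.eval_zero]
  have h1 : Continuous fun p : NetParams ι κ 0 W × (ι → ℝ) => p.1.1.1.mulVec p.2 + p.1.1.2 :=
    (Continuous.matrix_mulVec (continuous_fst.comp (continuous_fst.comp continuous_fst))
      continuous_snd).add (continuous_snd.comp (continuous_fst.comp continuous_fst))
  have h2 : Continuous fun p : NetParams ι κ 0 W × (ι → ℝ) => p.1.2.2 :=
    continuous_snd.comp (continuous_snd.comp continuous_fst)
  exact (Continuous.matrix_mulVec (continuous_fst.comp h2)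
    (continuous_pi fun i => hσ.comp ((continuous_apply i).comp h1))).add (continuous_snd.comp h2)

theorem Layer.isCompact_setOf_boundedBy (M : ℝ) :
    IsCompact {A : Layer ι κ | A.BoundedBy M} := by
  have h1 : IsCompact {A : κ → ι → ℝ | ∀ i j, |A i j| ≤ M} := by
    convert isCompact_univ_pi fun _ : κ => isCompact_univ_pi fun _ : ι =>
      isCompact_Icc (a := -M) (b := M) using 1
    ext A
    simp [abs_le, Pi.le_def, forall_and]
  have h2 : IsCompact {b : κ → ℝ | ∀ i, |b i| ≤ M} := by
    convert isCompact_univ_pi fun _ : κ => isCompact_Icc (a := -M) (b := M) using 1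
    ext b
    simp [abs_le, Pi.le_def, forall_and]
  exact h1.prod h2

/-- This compactness yields both the existence of empirical minimizers and the finite net of losses.
-/
theorem NetParams.isCompact_setOf_boundedBy (L W : ℕ) (M : ℝ) :
    IsCompact {θ : NetParams ι κ L W | θ.BoundedBy M} := by
  convert (Layer.isCompact_setOf_boundedBy (ι := ι) (κ := Fin W) M).prod
    ((isCompact_univ_pi fun _ : Fin L =>
      Layer.isCompact_setOf_boundedBy (ι := Fin W) (κ := Fin W) M).prod
      (Layer.isCompact_setOf_boundedBy (ι := Fin W) (κ := κ) M)) using 1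
  ext θ
  simp [NetParams.BoundedBy]

theorem Layer.exists_boundedBy [Finite ι] [Finite κ] (A : Layer ι κ) : ∃ M, A.BoundedBy M := by
  obtain ⟨M₁, h₁⟩ := Finite.exists_le fun p : κ × ι => |A.1 p.1 p.2|
  obtain ⟨M₂, h₂⟩ := Finite.exists_le fun i : κ => |A.2 i|
  exact ⟨max M₁ M₂, fun i j => (h₁ (i, j)).trans (le_max_left _ _),
    fun i => (h₂ i).trans (le_max_right _ _)⟩

theorem Layer.BoundedBy.mono {A : Layer ι κ} {M M' : ℝ} (h : A.BoundedBy M) (hM : M ≤ M') :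
    A.BoundedBy M' :=
  ⟨fun i j => (h.1 i j).trans hM, fun i => (h.2 i).trans hM⟩

theorem NetParams.exists_boundedBy [Finite ι] [Finite κ] {L W : ℕ} (θ : NetParams ι κ L W) :
    ∃ M, θ.BoundedBy M := by
  obtain ⟨M₁, h₁⟩ := θ.1.exists_boundedBy
  choose m hm using fun l => (θ.2.1 l).exists_boundedBy
  obtain ⟨M₂, h₂⟩ := Finite.exists_le m
  obtain ⟨M₃, h₃⟩ := θ.2.2.exists_boundedBy
  exact ⟨max M₁ (max M₂ M₃), h₁.mono (le_max_left _ _),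
    fun l => (hm l).mono ((h₂ l).trans ((le_max_left _ _).trans (le_max_right _ _))),
    h₃.mono ((le_max_right _ _).trans (le_max_right _ _))⟩

/-- Shallow networks approximate continuous functions on compact spaces uniformly. -/
theorem NetParams.exists_eval_near [Fintype ι] [Finite κ] {Z : Type*} [TopologicalSpace Z]
    [CompactSpace Z] {σ : ℝ → ℝ} (hσ : Continuous σ)
    (hσp : ¬ ∃ p : Polynomial ℝ, ∀ t, σ t = p.eval t) (e : C(Z, ι → ℝ))
    (he : Function.Injective e) (T : κ → C(Z, ℝ)) {ε : ℝ} (hε : 0 < ε) :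
    ∃ (W : ℕ) (θ : NetParams ι κ 0 W), ∀ z i, |θ.eval σ (e z) i - T i z| < ε := by
  classical
  have := Fintype.ofFinite κ
  have hdense := topologicalClosure_span_comp_affineFeature ⟨σ, hσ⟩ hσp e he
  have hnear : ∀ i, ∃ c : ((ι → ℝ) × ℝ) →₀ ℝ,
      dist (T i) (c.sum fun q r => r • (⟨σ, hσ⟩ : C(ℝ, ℝ)).comp (affineFeature e q.1 q.2)) < ε := by
    intro i
    have h1 : T i ∈ closure (Submodule.span ℝ (range fun q : (ι → ℝ) × ℝ =>
        (⟨σ, hσ⟩ : C(ℝ, ℝ)).comp (affineFeature e q.1 q.2)) : Set C(Z, ℝ)) := by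
      rw [← Submodule.topologicalClosure_coe, hdense]; trivial
    obtain ⟨g, hg, hgd⟩ := Metric.mem_closure_iff.1 h1 ε hε
    obtain ⟨c, rfl⟩ := Finsupp.mem_span_range_iff_exists_finsupp.1 hg
    exact ⟨c, hgd⟩
  choose c hc using hnear
  -- All output coordinates share one hidden layer: one neuron for each feature used by some
  -- coordinate, with output weight zero where it is not used.
  let s : Finset ((ι → ℝ) × ℝ) := Finset.univ.biUnion fun i => (c i).support
  let q : Fin s.card ≃ s := s.equivFin.symm
  refine ⟨s.card, ((Matrix.of fun j => (q j).1.1, fun j => (q j).1.2), Fin.elim0,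
    (Matrix.of fun i j => c i (q j), 0)), fun z i => ?_⟩
  refine lt_of_le_of_lt (le_of_eq ?_) ((ContinuousMap.dist_apply_le_dist z).trans_lt (hc i))
  rw [dist_comm, Real.dist_eq, NetParams.eval_zero]
  congr 2
  have hsub : (c i).support ⊆ s := Finset.subset_biUnion_of_mem (fun i => (c i).support)
    (Finset.mem_univ i)
  rw [Finsupp.sum_of_support_subset _ hsub _ (by simp), ← Finset.sum_coe_sort,
    ContinuousMap.sum_apply, ← q.sum_comp]
  simp [Matrix.mulVec, dotProduct, affineFeature]

end Networks

/-! ### Empirical risk minimization -/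

/-- Chebyshev's inequality for the mean of `N` independent samples. -/
theorem measure_pi_le_abs_mean_sub_integral {Ω : Type*} [MeasurableSpace Ω] {μ : Measure Ω}
    [IsProbabilityMeasure μ] {g : Ω → ℝ} (hg : MemLp g 2 μ) {N : ℕ} (hN : 0 < N) {c : ℝ}
    (hc : 0 < c) :
    Measure.pi (fun _ : Fin N => μ) {x | c ≤ |(∑ j, g (x j)) / N - ∫ ω, g ω ∂μ|} ≤
      ENNReal.ofReal (Var[g; μ] / (N * c ^ 2)) := by
  have hN' : (0 : ℝ) < N := Nat.cast_pos.2 hN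
  have hgj : ∀ j : Fin N, MemLp (fun x : Fin N → Ω => g (x j)) 2 (Measure.pi fun _ => μ) :=
    fun j => hg.comp_measurePreserving (measurePreserving_eval (fun _ => μ) j)
  have hmem : MemLp (∑ j : Fin N, fun x : Fin N → Ω => g (x j)) 2 (Measure.pi fun _ => μ) :=
    memLp_finsetSum' _ fun j _ => hgj j
  have hmean : ∫ x, (∑ j : Fin N, fun x : Fin N → Ω => g (x j)) x ∂(Measure.pi fun _ => μ) =
      N * ∫ ω, g ω ∂μ := by
    simp only [Finset.sum_apply]
    rw [integral_finsetSum _ fun j _ => (hgj j).integrable one_le_two]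
    have : ∀ j : Fin N, ∫ x : Fin N → Ω, g (x j) ∂(Measure.pi fun _ => μ) = ∫ ω, g ω ∂μ := by
      intro j
      exact integral_comp_eval (μ := fun _ : Fin N => μ) hg.aestronglyMeasurable
    simp [this]
  have hvar : Var[∑ j : Fin N, fun x : Fin N → Ω => g (x j); Measure.pi fun _ => μ] =
      N * Var[g; μ] := by
    rw [variance_sum_pi (μ := fun _ : Fin N => μ) (X := fun _ => g) fun _ => hg]
    simp
  -- Applied to the sum, hence the threshold `N * c` against the variance `N * Var[g; μ]`.
  have h := meas_ge_le_variance_div_sq hmem (c := N * c) (by positivity)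
  rw [hvar, hmean] at h
  have hr : (N : ℝ) * Var[g; μ] / (N * c) ^ 2 = Var[g; μ] / (N * c ^ 2) := by
    field_simp
  rw [hr] at h
  refine le_trans (measure_mono fun x hx => ?_) h
  simp only [mem_ofPred_eq, Finset.sum_apply] at hx ⊢
  have : (∑ j, g (x j)) - N * ∫ ω, g ω ∂μ = N * ((∑ j, g (x j)) / N - ∫ ω, g ω ∂μ) := by
    field_simp
  rw [this, abs_mul, abs_of_pos hN']
  gcongr

/-- Empirical risk minimization over a compact parameter space succeeds if the loss is jointly
continuous on the state space and some parameter has uniformly small loss. -/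
theorem exists_forall_ERMSucceeds {n : ℕ} {X : Set (EuclideanSpace ℝ (Fin n))} (hX : IsCompact X)
    (μ : Measure (EuclideanSpace ℝ (Fin n))) [IsProbabilityMeasure μ] (hμX : ∀ᵐ x ∂μ, x ∈ X)
    {F : Type} {Θ : Type*} [TopologicalSpace Θ] [CompactSpace Θ] (net : Θ → F)
    (loss : F → EuclideanSpace ℝ (Fin n) → ℝ) (hnonneg : ∀ η x, 0 ≤ loss η x)
    (hcont : ∀ x, Continuous fun θ => loss (net θ) x)
    (hjoint : Continuous fun p : Θ × X => loss (net p.1) p.2)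
    {ε δ : ℝ} (hε : 0 < ε) (hδ : 0 < δ) (θ₀ : Θ) (hθ₀ : ∀ x ∈ X, loss (net θ₀) x ≤ ε / 2) :
    ∃ N₀ : ℕ, ∀ N, N₀ ≤ N → ERMSucceeds μ loss (range net) N ε δ := by
  -- Error budget: `ε / 2` for approximation, plus `r` three times (two passages to the net, one
  -- concentration bound), in total `7 * ε / 8`.
  have : CompactSpace X := isCompact_iff_compactSpace.1 hX
  set r : ℝ := ε / 8 with hr
  have hr0 : 0 < r := by positivity
  -- Currying turns joint continuity into sup-norm continuity in the parameter; compactness of `Θ`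
  -- then gives the finite net `t`.
  let Φ : C(Θ, C(X, ℝ)) := ContinuousMap.curry ⟨fun p : Θ × X => loss (net p.1) p.2, hjoint⟩
  obtain ⟨t, ht⟩ := CompactSpace.elim_nhds_subcover (fun θ => Φ ⁻¹' Metric.ball (Φ θ) r)
    fun θ => Φ.continuous.continuousAt.preimage_mem_nhds (Metric.ball_mem_nhds _ hr0)
  have hnet : ∀ θ, ∃ θ' ∈ t, ∀ x ∈ X, |loss (net θ) x - loss (net θ') x| ≤ r := by
    intro θ
    have hθ : θ ∈ ⋃ θ' ∈ t, Φ ⁻¹' Metric.ball (Φ θ') r := by rw [ht]; trivial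
    simp only [mem_iUnion, mem_preimage, Metric.mem_ball, exists_prop] at hθ
    obtain ⟨θ', hθ', hd⟩ := hθ
    exact ⟨θ', hθ', fun x hx => (ContinuousMap.dist_apply_le_dist (⟨x, hx⟩ : X)).trans hd.le⟩
  -- Off `X` the loss need not be measurable in the state. Cutting it off there changes it only on a
  -- null set.
  let g : Θ → EuclideanSpace ℝ (Fin n) → ℝ := fun θ => X.indicator (loss (net θ))
  have hgX : ∀ θ, ∀ x ∈ X, g θ x = loss (net θ) x := fun θ x hx => indicator_of_mem hx _
  have hgae : ∀ θ, g θ =ᵐ[μ] loss (net θ) := fun θ => by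
    filter_upwards [hμX] with x hx using hgX θ x hx
  have hcontX : ∀ θ, ContinuousOn (loss (net θ)) X := fun θ => by
    rw [continuousOn_iff_continuous_domRestrict]
    exact hjoint.comp (Continuous.prodMk_right θ)
  have hgm : ∀ θ, AEStronglyMeasurable (g θ) μ := fun θ =>
    (aestronglyMeasurable_indicator_iff hX.measurableSet).2
      ((hcontX θ).aestronglyMeasurable hX.measurableSet)
  have hgL2 : ∀ θ, MemLp (g θ) 2 μ := fun θ => by
    obtain ⟨C, hC⟩ := hX.exists_bound_of_continuousOn (hcontX θ)
    refine MemLp.of_bound (hgm θ) C ?_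
    filter_upwards [hμX] with x hx
    rw [hgX θ x hx]
    exact hC x hx
  have hgint : ∀ θ, Integrable (g θ) μ := fun θ => (hgL2 θ).integrable one_le_two
  have hrisk : ∀ θ, risk μ loss (net θ) = ENNReal.ofReal (∫ x, g θ x ∂μ) := fun θ => by
    rw [ofReal_integral_eq_lintegral_ofReal (hgint θ)
      (Eventually.of_forall fun x => indicator_nonneg (fun x _ => hnonneg _ x) x)]
    exact lintegral_congr_ae ((hgae θ).mono fun x hx => by simp only [hx])
  -- Chosen so that the Chebyshev bounds, summed over the net, are at most `δ`; the later `+ 1`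
  -- ensures `0 < N`.
  obtain ⟨N₁, hN₁⟩ := exists_nat_ge ((∑ θ ∈ t, Var[g θ; μ]) / (r ^ 2 * δ))
  refine ⟨N₁ + 1, fun N hN => ?_⟩
  have hN0 : 0 < N := by omega
  have hN0' : (0 : ℝ) < N := Nat.cast_pos.2 hN0
  refine ⟨fun x => ?_, fun ηhat hηhat => ?_⟩
  · obtain ⟨θ, -, hθ⟩ := isCompact_univ.exists_isMinOn ⟨θ₀, mem_univ θ₀⟩
      (f := fun θ => empiricalRisk loss x (net θ)) (by
        unfold empiricalRisk
        exact ((continuous_finsetSum _ fun j _ => hcont (x j)).div_const _).continuousOn)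
    refine ⟨net θ, ⟨θ, rfl⟩, ?_⟩
    rintro _ ⟨θ', rfl⟩
    exact hθ (mem_univ θ')
  set P : Measure (Fin N → EuclideanSpace ℝ (Fin n)) := Measure.pi fun _ => μ with hP
  have hXae : ∀ᵐ x ∂P, ∀ j, x j ∈ X := by
    rw [ae_all_iff]
    intro j
    exact (Measure.quasiMeasurePreserving_eval (fun _ : Fin N => μ) j).ae hμX
  -- This event involves only the net, so the same event serves every choice of minimizer.
  let bad : Set (Fin N → EuclideanSpace ℝ (Fin n)) :=
    ⋃ θ ∈ t, {x | r ≤ |(∑ j, g θ (x j)) / N - ∫ ω, g θ ω ∂μ|}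
  let null : Set (Fin N → EuclideanSpace ℝ (Fin n)) :=
    {x | ¬ (IsERM loss (range net) x (ηhat x) ∧ ∀ j, x j ∈ X)}
  have hnull : P null = 0 := ae_iff.1 (hηhat.and hXae)
  have hbad : P bad ≤ ENNReal.ofReal δ := by
    calc P bad ≤ ∑ θ ∈ t, P {x | r ≤ |(∑ j, g θ (x j)) / N - ∫ ω, g θ ω ∂μ|} :=
          measure_biUnion_finset_le _ _
      _ ≤ ∑ θ ∈ t, ENNReal.ofReal (Var[g θ; μ] / (N * r ^ 2)) :=
          Finset.sum_le_sum fun θ _ => measure_pi_le_abs_mean_sub_integral (hgL2 θ) hN0 hr0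
      _ = ENNReal.ofReal (∑ θ ∈ t, Var[g θ; μ] / (N * r ^ 2)) :=
          (ENNReal.ofReal_sum_of_nonneg fun θ _ =>
            div_nonneg (variance_nonneg _ _) (by positivity)).symm
      _ ≤ ENNReal.ofReal δ := by
          refine ENNReal.ofReal_le_ofReal ?_
          rw [← Finset.sum_div, div_le_iff₀ (by positivity)]
          rw [div_le_iff₀ (by positivity)] at hN₁
          have h1 : (N₁ : ℝ) ≤ N := by exact_mod_cast (Nat.le_succ N₁).trans hN
          calc _ ≤ _ := hN₁
            _ ≤ (N : ℝ) * (r ^ 2 * δ) := by gcongr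
            _ = _ := by ring
  have hmeas : MeasurableSet (toMeasurable P (bad ∪ null)) := measurableSet_toMeasurable _ _
  -- `ηhat` is an arbitrary selection, so `null` may be non-measurable; its union with `bad` is
  -- replaced by a measurable hull of equal measure.
  refine ⟨(toMeasurable P (bad ∪ null))ᶜ, hmeas.compl, fun x hx => ?_, ?_⟩
  · have hx' : x ∉ bad ∪ null := fun h => hx (subset_toMeasurable _ _ h)
    rw [mem_union, not_or] at hx'
    obtain ⟨hxbad, hxnull⟩ := hx'
    obtain ⟨⟨⟨θ, hθ⟩, hmin⟩, hxX⟩ := not_not.1 hxnull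
    rw [← hθ] at hmin
    have hgood : ∀ θ' ∈ t, |(∑ j, g θ' (x j)) / N - ∫ ω, g θ' ω ∂μ| < r := by
      intro θ' hθ'
      by_contra hcon
      exact hxbad (mem_biUnion hθ' (not_lt.1 hcon))
    obtain ⟨θ', hθ', hd⟩ := hnet θ
    change risk μ loss (ηhat x) ≤ _
    rw [← hθ, hrisk]
    refine ENNReal.ofReal_le_ofReal ?_
    have h1 : ∫ ω, g θ ω ∂μ ≤ ∫ ω, g θ' ω ∂μ + r := by
      have : ∫ ω, g θ ω ∂μ ≤ ∫ ω, (g θ' ω + r) ∂μ := by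
        refine integral_mono_ae (hgint θ) ((hgint θ').add (integrable_const r)) ?_
        filter_upwards [hμX] with ω hω
        simp only [hgX _ ω hω]
        linarith [(abs_le.1 (hd ω hω)).2]
      rwa [integral_add (hgint θ') (integrable_const r), integral_const, probReal_univ,
        one_smul] at this
    have h2 := (abs_lt.1 (hgood θ' hθ')).1
    have h3 : (∑ j, g θ' (x j)) / N ≤ empiricalRisk loss x (net θ) + r := by
      rw [empiricalRisk, div_add' _ _ _ hN0'.ne']
      gcongr
      calc ∑ j, g θ' (x j) ≤ ∑ j, (loss (net θ) (x j) + r) := by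
            refine Finset.sum_le_sum fun j _ => ?_
            rw [hgX _ _ (hxX j)]
            linarith [(abs_le.1 (hd _ (hxX j))).1]
        _ = _ := by simp [Finset.sum_add_distrib, mul_comm]
    have h4 := hmin _ ⟨θ₀, rfl⟩
    have h5 : empiricalRisk loss x (net θ₀) ≤ ε / 2 := by
      rw [empiricalRisk, div_le_iff₀ hN0']
      calc ∑ j, loss (net θ₀) (x j) ≤ ∑ _j : Fin N, ε / 2 :=
            Finset.sum_le_sum fun j _ => hθ₀ _ (hxX j)
        _ = _ := by simp [mul_comm]
    linarith
  · rw [prob_compl_eq_one_sub hmeas, measure_toMeasurable, ENNReal.ofReal_sub _ hδ.le,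
      ENNReal.ofReal_one]
    gcongr
    calc P (bad ∪ null) ≤ P bad + P null := measure_union_le _ _
      _ ≤ _ := by rw [hnull, add_zero]; exact hbad

/-! ### Learning a continuous map from trajectories -/

/-- Empirical risk minimization over shallow networks learns a continuous map `T` on a compact set
from the averaged quadratic loss along finitely many continuous observations. -/
theorem exists_netClass_ERMSucceeds {n m q k : ℕ} {X : Set (EuclideanSpace ℝ (Fin n))}
    (hX : IsCompact X) (μ : Measure (EuclideanSpace ℝ (Fin n))) [IsProbabilityMeasure μ]
    (hμX : ∀ᵐ x ∂μ, x ∈ X) {σ : ℝ → ℝ} (hσ : Continuous σ)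
    (hσp : ¬ ∃ p : Polynomial ℝ, ∀ t, σ t = p.eval t)
    {s : Finset ℕ} (hs : s.Nonempty) {Y : Set (Fin k → EuclideanSpace ℝ (Fin m))} (hY : IsCompact Y)
    {T : (Fin k → EuclideanSpace ℝ (Fin m)) → EuclideanSpace ℝ (Fin q)} (hT : ContinuousOn T Y)
    {a : ℕ → EuclideanSpace ℝ (Fin n) → Fin k → EuclideanSpace ℝ (Fin m)}
    {b : ℕ → EuclideanSpace ℝ (Fin n) → EuclideanSpace ℝ (Fin q)}
    (ha : ∀ l ∈ s, ContinuousOn (a l) X) (haY : ∀ l ∈ s, MapsTo (a l) X Y)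
    (hab : ∀ l ∈ s, ∀ x ∈ X, T (a l x) = b l x)
    {loss : ((Fin k → EuclideanSpace ℝ (Fin m)) → EuclideanSpace ℝ (Fin q)) →
      EuclideanSpace ℝ (Fin n) → ℝ}
    (hloss : ∀ η x, loss η x = (∑ l ∈ s, ‖η (a l x) - b l x‖ ^ 2) / (s.card : ℝ))
    {ε δ : ℝ} (hε : 0 < ε) (hδ : 0 < δ) :
    ∃ (W : ℕ) (M : ℝ) (N₀ : ℕ), ∀ N : ℕ, N₀ ≤ N →
      ERMSucceeds μ loss (netClass σ k m q 0 W M) N ε δ := by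
  have : CompactSpace Y := isCompact_iff_compactSpace.1 hY
  have hs' : (0 : ℝ) < s.card := by exact_mod_cast hs.card_pos
  have hflat : Continuous fun (y : Fin k → EuclideanSpace ℝ (Fin m)) (p : Fin k × Fin m) =>
      y p.1 p.2 := by fun_prop
  let e : C(Y, Fin k × Fin m → ℝ) := ⟨fun y p => (y : Fin k → EuclideanSpace ℝ (Fin m)) p.1 p.2,
    hflat.comp continuous_subtype_val⟩
  have he : Function.Injective e := by
    intro y y' h
    ext i j
    exact congrFun h (i, j)
  let T' : Fin q → C(Y, ℝ) := fun i => ⟨fun y => T y i,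
    (show Continuous fun v : EuclideanSpace ℝ (Fin q) => v i by fun_prop).comp
      (continuousOn_iff_continuous_domRestrict.1 hT)⟩
  -- With coordinate errors below `ρ`, the squared norm is at most `q * ρ ^ 2 ≤ ε / 2`; `q + 1` also
  -- covers `q = 0`.
  set ρ : ℝ := Real.sqrt (ε / 2 / (q + 1)) with hρ
  have hρ0 : 0 < ρ := Real.sqrt_pos.2 (by positivity)
  obtain ⟨W, θ₀, hθ₀⟩ := NetParams.exists_eval_near hσ hσp e he T' hρ0
  -- The weight bound is read off the approximating network, which therefore belongs to the class.
  obtain ⟨M, hM⟩ := θ₀.exists_boundedBy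
  let Θ : Type := {θ : NetParams (Fin k × Fin m) (Fin q) 0 W // θ.BoundedBy M}
  have : CompactSpace Θ := isCompact_iff_compactSpace.1 (NetParams.isCompact_setOf_boundedBy 0 W M)
  let net : Θ → (Fin k → EuclideanSpace ℝ (Fin m)) → EuclideanSpace ℝ (Fin q) :=
    fun θ y => WithLp.toLp 2 (θ.1.eval σ fun p => y p.1 p.2)
  have hrange : range net = netClass σ k m q 0 W M := by
    ext η
    constructor
    · rintro ⟨θ, rfl⟩
      exact ⟨θ.1, θ.2, fun _ => rfl⟩
    · rintro ⟨θ, hθ, h⟩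
      exact ⟨⟨θ, hθ⟩, (funext h).symm⟩
  have hnet : Continuous fun p : Θ × (Fin k → EuclideanSpace ℝ (Fin m)) => net p.1 p.2 :=
    (PiLp.continuous_toLp 2 _).comp ((NetParams.continuous_eval_zero hσ).comp
      ((continuous_subtype_val.comp continuous_fst).prodMk (hflat.comp continuous_snd)))
  have haX : ∀ l ∈ s, Continuous fun x : X => a l x := fun l hl =>
    continuousOn_iff_continuous_domRestrict.1 (ha l hl)
  have hbX : ∀ l ∈ s, Continuous fun x : X => b l x := fun l hl =>
    continuousOn_iff_continuous_domRestrict.1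
      ((hT.comp (ha l hl) (haY l hl)).congr fun x hx => (hab l hl x hx).symm)
  refine ⟨W, M, ?_⟩
  rw [← hrange]
  refine exists_forall_ERMSucceeds hX μ hμX net loss (fun η x => ?_) (fun x => ?_) ?_ hε hδ
    ⟨θ₀, hM⟩ fun x hx => ?_
  · rw [hloss]
    positivity
  · simp only [hloss]
    refine (continuous_finsetSum _ fun l _ => ?_).div_const _
    exact (((hnet.comp (Continuous.prodMk_left (a l x))).sub continuous_const).norm).pow 2
  · simp only [hloss]
    refine (continuous_finsetSum _ fun l hl => ?_).div_const _
    have h1 : Continuous fun p : Θ × X => net p.1 (a l p.2) :=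
      hnet.comp (continuous_fst.prodMk ((haX l hl).comp continuous_snd))
    exact ((h1.sub ((hbX l hl).comp continuous_snd)).norm).pow 2
  · rw [hloss, div_le_iff₀ hs', mul_comm, ← nsmul_eq_mul]
    refine Finset.sum_le_card_nsmul _ _ _ fun l hl => ?_
    rw [← hab l hl x hx, EuclideanSpace.norm_sq_eq]
    calc _ ≤ ∑ _i : Fin q, ε / 2 / (q + 1) := by
          refine Finset.sum_le_sum fun i _ => ?_
          rw [← Real.sq_sqrt (show 0 ≤ ε / 2 / ((q : ℝ) + 1) by positivity), ← hρ]
          have := (hθ₀ ⟨a l x, haY l hl hx⟩ i).le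
          rw [Real.norm_eq_abs]
          gcongr
          exact this
      _ = (q : ℝ) / (q + 1) * (ε / 2) := by simp; ring
      _ ≤ 1 * (ε / 2) := by
          gcongr
          exact div_le_one_of_le₀ (by linarith) (by positivity)
      _ = ε / 2 := one_mul _

end WorldModel

theorem theorem1 {n m : ℕ} (hmn : m ≤ n)
    -- the state space and the dynamics
    (X : Set (EuclideanSpace ℝ (Fin n))) (hX : IsCompact X)
    (hbdry : WorldModel.HasDifferentiableBoundary X)
    (f : EuclideanSpace ℝ (Fin n) → EuclideanSpace ℝ (Fin n))
    (Lf : NNReal) (hf : LipschitzWith Lf f) (hft : WorldModel.IsTangentToBoundary X f)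
    -- the tokenization map
    (h : EuclideanSpace ℝ (Fin n) → EuclideanSpace ℝ (Fin m)) (hh : ContinuousOn h X)
    -- time step, history length, and observation horizon `T = K * Δ`
    (Δ : ℝ) (hΔ : 0 < Δ) (k K : ℕ) (hk : 1 ≤ k) (hK : k < K)
    -- observability
    (G : (Fin k → EuclideanSpace ℝ (Fin m)) → EuclideanSpace ℝ (Fin n))
    (hG : WorldModel.IsReconstructionMap X f h Δ k K G)
    -- the distribution of the initial states
    (μ : Measure (EuclideanSpace ℝ (Fin n)))
    (hμ : WorldModel.HasPositiveContinuousDensityOn μ X)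
    -- the activation function
    (σ : ℝ → ℝ) (hσ : Continuous σ) (hσp : ¬ ∃ p : Polynomial ℝ, ∀ t, σ t = p.eval t)
    (ε δ : ℝ) (hε : 0 < ε) (hδ : 0 < δ) :
    ∃ (Lg Wg : ℕ) (Mg : ℝ) (LG WG : ℕ) (MG : ℝ) (N₀ : ℕ), ∀ N : ℕ, N₀ ≤ N →
      WorldModel.ERMSucceeds μ (WorldModel.tokenLoss f h Δ k K)
        (WorldModel.netClass σ k m m Lg Wg Mg) N ε δ ∧
      WorldModel.ERMSucceeds μ (WorldModel.stateLoss f h Δ k K)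
        (WorldModel.netClass σ k m n LG WG MG) N ε δ := by
  obtain ⟨hprob, fμ, -, -, hμeq⟩ := hμ
  have hμX : ∀ᵐ x ∂μ, x ∈ X := by
    rw [hμeq]
    exact (withDensity_absolutelyContinuous _ _).ae_le (ae_restrict_mem hX.measurableSet)
  have hmem : ∀ {t : ℝ}, 0 ≤ t → MapsTo (WorldModel.trajectory f t) X X := fun ht x hx =>
    WorldModel.trajectory_mem hX hbdry hf hft hx ht
  have hcont : ∀ {t : ℝ}, 0 ≤ t → ContinuousOn (WorldModel.trajectory f t) X := fun ht =>
    WorldModel.continuousOn_trajectory hX hbdry hf hft ht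
  -- The earliest time in the history is `(l - k + 1) * Δ`, so forward invariance suffices.
  have htime : ∀ {l : ℕ}, k ≤ l → ∀ i : Fin k, 0 ≤ (l : ℝ) * Δ - ((k : ℝ) - 1 - (i : ℕ)) * Δ := by
    intro l hl i
    have h1 : (k : ℝ) ≤ l := by exact_mod_cast hl
    have h2 : (0 : ℝ) ≤ (i : ℕ) := Nat.cast_nonneg _
    rw [← sub_mul]
    exact mul_nonneg (by linarith) hΔ.le
  have hY : IsCompact (Set.univ.pi fun _ : Fin k => h '' X) :=
    isCompact_univ_pi fun _ => hX.image_of_continuousOn hh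
  have hseqY : ∀ {l : ℕ}, k ≤ l → MapsTo (WorldModel.tokenSeq f h Δ k ((l : ℝ) * Δ)) X
      (Set.univ.pi fun _ : Fin k => h '' X) := fun hl x hx i _ =>
    mem_image_of_mem h (hmem (htime hl i) hx)
  have hseq : ∀ {l : ℕ}, k ≤ l → ContinuousOn (WorldModel.tokenSeq f h Δ k ((l : ℝ) * Δ)) X :=
    fun hl => continuousOn_pi.2 fun i => hh.comp (hcont (htime hl i)) (hmem (htime hl i))
  -- The token target is the autoregressive map: reconstruct the state by `G`, flow for time `Δ`,
  -- observe by `h`. The semigroup law identifies its value with the next token.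
  obtain ⟨Wg, Mg, Ng, hg⟩ := WorldModel.exists_netClass_ERMSucceeds hX μ hμX hσ hσp
    (s := Finset.Ico k K) (Finset.nonempty_Ico.2 hK) hY
    (T := fun y => h (WorldModel.trajectory f Δ (G y)))
    (hh.comp ((hcont hΔ.le).comp hG.continuousOn hG.mapsTo) ((hmem hΔ.le).comp hG.mapsTo))
    (a := fun l => WorldModel.tokenSeq f h Δ k ((l : ℝ) * Δ))
    (b := fun l => WorldModel.token f h ((l : ℝ) * Δ + Δ))
    (fun l hl => hseq (Finset.mem_Ico.1 hl).1) (fun l hl => hseqY (Finset.mem_Ico.1 hl).1)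
    (fun l hl x hx => by
      have hl := Finset.mem_Ico.1 hl
      simp only [WorldModel.token]
      rw [hG.reconstructs x hx l (by omega) (by omega),
        WorldModel.trajectory_add hX hbdry hf hft hx (by positivity)])
    (loss := WorldModel.tokenLoss f h Δ k K) (fun _ _ => rfl) hε hδ
  obtain ⟨WG, MG, NG, hGN⟩ := WorldModel.exists_netClass_ERMSucceeds hX μ hμX hσ hσp
    (s := Finset.Icc k K) (Finset.nonempty_Icc.2 hK.le) hY hG.continuousOn
    (a := fun l => WorldModel.tokenSeq f h Δ k ((l : ℝ) * Δ))
    (b := fun l => WorldModel.trajectory f ((l : ℝ) * Δ))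
    (fun l hl => hseq (Finset.mem_Icc.1 hl).1) (fun l hl => hseqY (Finset.mem_Icc.1 hl).1)
    (fun l hl x hx => by
      have hl := Finset.mem_Icc.1 hl
      exact hG.reconstructs x hx l (by omega) (by omega))
    (loss := WorldModel.stateLoss f h Δ k K) (fun _ _ => rfl) hε hδ
  exact ⟨0, Wg, Mg, 0, WG, MG, max Ng NG, fun N hN =>
    ⟨hg N ((le_max_left _ _).trans hN), hGN N ((le_max_right _ _).trans hN)⟩⟩
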